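/- Let $q\in\mathbb{C}$ with $0<|q|<1$. For $k\in\mathbb{Z}$ let $(a;q)_k=(a;q)_\infty/(aq^k;q)_\infty$, that is, $(a;q)_k=\prod_{i=0}^{k-1}(1-aq^i)$ for $k\ge 0$ and $(a;q)_{-m}=\prod_{i=1}^{m}(1-aq^{-i})^{-1}$ for $m\ge1$, and put $(a_1,\dots,a_m;q)_k=\prod_{i}(a_i;q)_k$. Let $${}_r\phi_s\left[{a_1,\dots,a_r\atop b_1,\dots,b_s};q,x\right]=\sum_{k=0}^{\infty}\frac{(a_1,\dots,a_r;q)_k}{(b_1,\dots,b_s;q)_k}\left((-1)^kq^{\binom k2}\right)^{s+1-r}\frac{x^k}{(q;q)_k},$$ $${}_r\psi_r\left[{a_1,\dots,a_r\atop b_1,\dots,b_r};q,x\right]=\sum_{k=-\infty}^{\infty}\frac{(a_1,\dots,a_r;q)_k}{(b_1,\dots,b_r;q)_k}x^k .$$ Let $n\ge0$ be an integer and let $b,c,d,e$ be nonzero complex numbers, none of which lies in $\{q,q^2,\dots,q^n\}$. The series below terminate: because of $q^{-n}$ and $q^{n+1}$, the terms of the ${}_5\psi_5$ with $|k|>n$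 and those of the ${}_4\phi_3$ with $k>n$ are zero (and are read as zero also when another factor of such a term is singular); a term with an infinite denominator factor is zero. (1) If $de\notin\{q,q^2,\dots,q^n\}$, then $${}_5\psi_5\left[{b,c,d,e,q^{-n}\atop q/b,q/c,q/d,q/e,q^{n+1}};q,\frac{q^{2+n}}{bcde}\right]=\frac{(q,q/(de);q)_n}{(q/d,q/e;q)_n}\;{}_4\phi_3\left[{q^{-n},d,e,q/(bc)\atop q/b,q/c,deq^{-n}};q,q\right].$$ (2) If $bcdeq^{-n}=q$, then $${}_5\psi_5\left[{b,c,d,e,q^{-n}\atop q/b,q/c,q/d,q/e,q^{n+1}};q,q\right]=\frac{(q,q/(bd),q/(be),q/(de);q)_n}{(q/b,q/d,q/e,q/(bde);q)_n}.$$ -/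

import Mathlib

noncomputable section

/-- The infinite `q`-shifted factorial `(a; q)_∞ = ∏_{k ≥ 0} (1 - a q^k)`. -/
def qPochInf (a q : ℂ) : ℂ := ∏' k : ℕ, (1 - a * q ^ k)

/-- The `q`-shifted factorial `(a; q)_k` for an integer `k`:
`(a; q)_k = (1 - a)(1 - a q) ⋯ (1 - a q^(k-1))` for `k ≥ 0`, and
`(a; q)_{-m} = 1 / ((1 - a q^{-1})(1 - a q^{-2}) ⋯ (1 - a q^{-m}))` for `m ≥ 1`.
It is the quotient `(a; q)_∞ / (a q^k; q)_∞` whenever the latter has a nonzero denominator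
(see `qPoch_eq_div`); the finite products also give the usual value when that quotient is
`0 / 0`, as for `(q^{-n}; q)_k` with `0 ≤ k ≤ n`. -/
def qPoch (a q : ℂ) : ℤ → ℂ
  | Int.ofNat k => ∏ i ∈ Finset.range k, (1 - a * q ^ i)
  | Int.negSucc m => (∏ i ∈ Finset.range (m + 1), (1 - a * q ^ (-((i : ℤ) + 1))))⁻¹

/-- `(a₁, …, a_m; q)_k = (a₁; q)_k ⋯ (a_m; q)_k`. -/
def qPochMulti (as : List ℂ) (q : ℂ) (k : ℤ) : ℂ :=
  (as.map fun a => qPoch a q k).prod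

/-- The `k`-th term of the basic hypergeometric series `_rφ_s[as; bs; q, x]`,
where `r` and `s` are the lengths of the lists `as` and `bs`. -/
def phiTerm (as bs : List ℂ) (q x : ℂ) (k : ℕ) : ℂ :=
  qPochMulti as q k / qPochMulti bs q k
    * ((-1) ^ k * q ^ (k.choose 2)) ^ ((bs.length : ℤ) + 1 - (as.length : ℤ))
    * (x ^ k / qPoch q q k)

/-- The basic hypergeometric series `_rφ_s[as; bs; q, x]`. -/
def phiSeries (as bs : List ℂ) (q x : ℂ) : ℂ := ∑' k : ℕ, phiTerm as bs q x k

/-- The `k`-th term, `k ∈ ℤ`, of the bilateral series `_rψ_r[as; bs; q, x]`. -/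
def psiTerm (as bs : List ℂ) (q x : ℂ) (k : ℤ) : ℂ :=
  qPochMulti as q k / qPochMulti bs q k * x ^ k

/-- The bilateral basic hypergeometric series `_rψ_r[as; bs; q, x]`. -/
def psiSeries (as bs : List ℂ) (q x : ℂ) : ℂ := ∑' k : ℤ, psiTerm as bs q x k

/-- Splitting off the first `m` factors of `(a; q)_∞`. -/
theorem qPochInf_split (a q : ℂ) (hq : ‖q‖ < 1) (m : ℕ) :
    (∏ i ∈ Finset.range m, (1 - a * q ^ i)) * qPochInf (a * q ^ m) q = qPochInf a q := by
  have hm : Multipliable fun k : ℕ => 1 - a * q ^ (k + m) := by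
    have : Multipliable fun k : ℕ => 1 + -(a * q ^ (k + m)) := by
      apply multipliable_one_add_of_summable
      have h := (summable_geometric_of_lt_one (norm_nonneg q) hq).mul_left ‖a * q ^ m‖
      refine h.congr fun k => ?_
      simp only [norm_neg, norm_mul, norm_pow, pow_add]
      ring
    simpa only [sub_eq_add_neg] using this
  have h := Multipliable.prod_mul_tprod_nat_mul' (f := fun k : ℕ => 1 - a * q ^ k) hm
  unfold qPochInf
  rw [← h]
  congr 1
  refine tprod_congr fun k => ?_
  rw [pow_add]
  ring

/-- Agreement with the definition through infinite products. -/
theorem qPoch_eq_div (a q : ℂ) (hq0 : q ≠ 0) (hq : ‖q‖ < 1) (k : ℤ)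
    (h : qPochInf (a * q ^ k) q ≠ 0) :
    qPoch a q k = qPochInf a q / qPochInf (a * q ^ k) q := by
  rw [eq_div_iff h]
  cases k with
  | ofNat m =>
    have := qPochInf_split a q hq m
    simpa [qPoch] using this
  | negSucc m =>
    have hs := qPochInf_split (a * q ^ (Int.negSucc m)) q hq (m + 1)
    have e1 : a * q ^ (Int.negSucc m) * q ^ (m + 1) = a := by
      rw [zpow_negSucc, mul_assoc, inv_mul_cancel₀ (pow_ne_zero _ hq0), mul_one]
    have e2 : ∏ i ∈ Finset.range (m + 1), (1 - a * q ^ (Int.negSucc m) * q ^ i)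
        = ∏ i ∈ Finset.range (m + 1), (1 - a * q ^ (-((i : ℤ) + 1))) := by
      rw [← Finset.prod_range_reflect]
      refine Finset.prod_congr rfl fun i hi => ?_
      have hi' : i ≤ m := Nat.lt_succ_iff.mp (Finset.mem_range.mp hi)
      rw [mul_assoc, ← zpow_natCast q (m + 1 - 1 - i), ← zpow_add₀ hq0]
      congr 3
      rw [Int.negSucc_eq]
      omega
    rw [e1, e2] at hs
    rw [← hs] at h
    rw [← hs]
    simp only [qPoch]
    rw [← mul_assoc, inv_mul_cancel₀ (left_ne_zero_of_mul h), one_mul]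

end

/-!
The first identity is Watson's transformation of a terminating very-well-poised `₈φ₇` at `a = 1`,
the second is Jackson's sum at `a = 1`. The terms of the bilateral series with indices `k` and `-k`
differ by the factor `q^k` (`psiTerm_neg`), so that the series folds to a finite sum over
`0 ≤ k ≤ n` with weights `1` at `k = 0` and `1 + q^k` for `k ≥ 1`, which are the limits of
`(1 - a q^{2k}) (a; q)_k / ((1 - a) (q; q)_k)` as `a → 1`.

The part of the summand that depends on `b` and `c` is expanded in the functions
`(q^{-k}, q^k; q)_j` of `k` by the `q`-Pfaff--Saalschütz sum (`expansion_symPoch`). After the order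
of summation is exchanged, the inner sums over `k` involve only `d`, `e` and `n`, and have a product
form (`sum_psiThreeTerm_mul_symPoch`): for `j = 0` this is the limit `a = 1` of the `₆φ₅` sum,
proved by a telescoping argument (`sum_psiThreeTerm`), and a recurrence relating `(n, j + 1)` to
`(n - 1, j)` and `(n, j)` gives the other values of `j`.

The result, `sum_psiFive_eq`, contains the last factors of `(q/(de); q)_n` instead of the quotient
`(q/(de); q)_n / (de q^{-n}; q)_j`, and therefore needs no condition on `de`. If no denominator
factor `(de q^{-n}; q)_j` vanishes it is the first identity. If `bcde = q^{n+1}`, the factor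
`(q/(bc); q)_j` equals `(de q^{-n}; q)_j`, and the remaining balanced `₃φ₂` is summed by the
`q`-Pfaff--Saalschütz formula (`qSaalschutz`), which gives the second identity.
-/

open Finset

/-! ### Finite `q`-shifted factorials -/

/-- The `q`-shifted factorial `(a; q)_n` for a natural number `n`, as a finite product. -/
def qPochNat (a q : ℂ) (n : ℕ) : ℂ := ∏ i ∈ range n, (1 - a * q ^ i)

theorem qPoch_natCast (a q : ℂ) (n : ℕ) : qPoch a q (n : ℤ) = qPochNat a q n := rfl

@[simp] theorem qPochNat_zero (a q : ℂ) : qPochNat a q 0 = 1 := by simp [qPochNat]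

theorem qPochNat_succ (a q : ℂ) (n : ℕ) :
    qPochNat a q (n + 1) = qPochNat a q n * (1 - a * q ^ n) := by
  simp [qPochNat, prod_range_succ]

theorem qPochNat_succ' (a q : ℂ) (n : ℕ) :
    qPochNat a q (n + 1) = (1 - a) * qPochNat (a * q) q n := by
  simp [qPochNat, prod_range_succ', pow_succ', mul_assoc, mul_comm]

theorem qPochNat_add (a q : ℂ) (m n : ℕ) :
    qPochNat a q (m + n) = qPochNat a q m * qPochNat (a * q ^ m) q n := by
  simp [qPochNat, prod_range_add, pow_add, mul_assoc]

theorem qPochNat_ne_zero {a q : ℂ} {n : ℕ} (h : ∀ i < n, a * q ^ i ≠ 1) :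
    qPochNat a q n ≠ 0 :=
  prod_ne_zero_iff.2 fun i hi => sub_ne_zero.2 (h i (mem_range.1 hi)).symm

theorem qPochNat_ne_zero_of_le {a q : ℂ} {m n : ℕ} (hmn : m ≤ n) (h : qPochNat a q n ≠ 0) :
    qPochNat a q m ≠ 0 := by
  obtain ⟨l, rfl⟩ := Nat.exists_eq_add_of_le hmn
  rw [qPochNat_add] at h
  exact left_ne_zero_of_mul h

/-- The terminating factor: `(q^{-n}; q)_k = 0` for `k > n`. -/
theorem qPochNat_inv_pow_eq_zero {q : ℂ} (hq0 : q ≠ 0) {n k : ℕ} (h : n < k) :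
    qPochNat (1 / q ^ n) q k = 0 :=
  prod_eq_zero (mem_range.2 h) (by simp [hq0])

theorem one_sub_pow_ne_zero {q : ℂ} (hq1 : ‖q‖ < 1) (n : ℕ) : 1 - q ^ (n + 1) ≠ 0 := by
  intro h
  have h1 : ‖q ^ (n + 1)‖ = 1 := by rw [← sub_eq_zero.1 h, norm_one]
  rw [norm_pow] at h1
  exact (pow_lt_one₀ (norm_nonneg q) hq1 n.succ_ne_zero).ne h1

theorem qPochNat_pow_ne_zero {q : ℂ} (hq1 : ‖q‖ < 1) (m n : ℕ) :
    qPochNat (q ^ (m + 1)) q n ≠ 0 := by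
  refine qPochNat_ne_zero fun i _ h => one_sub_pow_ne_zero hq1 (m + i) ?_
  rw [sub_eq_zero, ← h]
  ring

theorem qPochNat_self_ne_zero {q : ℂ} (hq1 : ‖q‖ < 1) (n : ℕ) : qPochNat q q n ≠ 0 := by
  simpa using qPochNat_pow_ne_zero hq1 0 n

theorem qPochNat_div_ne_zero {q b : ℂ} (hb0 : b ≠ 0) {n : ℕ}
    (hb : ∀ j ∈ Icc 1 n, b ≠ q ^ j) : qPochNat (q / b) q n ≠ 0 := by
  refine qPochNat_ne_zero fun i hi h => hb (i + 1) (mem_Icc.2 ⟨by omega, by omega⟩) ?_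
  rw [div_mul_eq_mul_div, div_eq_one_iff_eq hb0] at h
  rw [← h, pow_succ']

theorem pow_choose_two_succ (q : ℂ) (k : ℕ) :
    q ^ ((k + 1).choose 2) = q ^ (k.choose 2) * q ^ k := by
  rw [Nat.choose_succ_succ' k 1, Nat.choose_one_right, pow_add, mul_comm]

/-- Reversal of the factors: the first `k` factors of `(w q^{-k-l}; q)_k` are, up to the factors
`-w q^{i-k-l}`, the last `k` factors of `(q/w; q)_{k+l}`. -/
theorem qPochNat_reverse {q w : ℂ} (hq0 : q ≠ 0) (hw : w ≠ 0) (k l : ℕ) :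
    qPochNat (w / q ^ (k + l)) q k * qPochNat (q / w) q l
      = qPochNat (q / w) q (k + l) * ((-w / q ^ (k + l)) ^ k * q ^ (k.choose 2)) := by
  induction k with
  | zero => simp
  | succ k ih =>
    have e : w / q ^ (k + 1 + l) * q = w / q ^ (k + l) := by
      field_simp
      ring
    have e' : -w / q ^ (k + l) = -w / q ^ (k + 1 + l) * q := by
      field_simp
      ring
    rw [qPochNat_succ', e, mul_assoc, ih, e', show k + 1 + l = (k + l) + 1 by ring,
      qPochNat_succ, pow_choose_two_succ, mul_pow, pow_succ (-w / q ^ (k + l + 1))]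
    have e2 : 1 - w / q ^ (k + l + 1) = (1 - q / w * q ^ (k + l)) * (-w / q ^ (k + l + 1)) := by
      field_simp
      ring
    rw [e2]
    ring

theorem qPochNat_reverse_self {q w : ℂ} (hq0 : q ≠ 0) (hw : w ≠ 0) (k : ℕ) :
    qPochNat (w / q ^ k) q k
      = qPochNat (q / w) q k * ((-w / q ^ k) ^ k * q ^ (k.choose 2)) := by
  simpa using qPochNat_reverse hq0 hw k 0

theorem pow_choose_two_sq (q : ℂ) (k : ℕ) :
    q ^ (k.choose 2) * q ^ (k.choose 2) * q ^ k = (q ^ k) ^ k := by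
  induction k with
  | zero => simp
  | succ k ih =>
    have : (q ^ (k + 1)) ^ (k + 1) = (q ^ k) ^ k * q ^ k * q ^ k * q := by ring
    rw [pow_choose_two_succ, this, ← ih]
    ring

/-! ### The `q`-Pfaff--Saalschütz sum -/

/-- The `q`-Pfaff--Saalschütz sum `₃φ₂[q^{-k}, A, B; C, ABq^{1-k}/C; q, q]` with denominators
cleared, in terms of `D = C/(AB)`. The summand for `k + 1` minus `(1 - ADq^k)(1 - BDq^k)` times the
summand for `k` telescopes. -/
theorem qSaalschutz_poly {q : ℂ} (hq1 : ‖q‖ < 1) (A B D : ℂ) (k : ℕ) :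
    ∑ j ∈ range (k + 1), qPochNat q q k / (qPochNat q q j * qPochNat q q (k - j))
        * (qPochNat A q j * qPochNat B q j * D ^ j)
        * (qPochNat (A * B * D * q ^ j) q (k - j) * qPochNat D q (k - j))
      = qPochNat (A * D) q k * qPochNat (B * D) q k := by
  induction k with
  | zero => simp
  | succ k ih =>
    have hne := qPochNat_self_ne_zero hq1
    -- The partial sums of the difference in closed form.
    have key : ∀ J ≤ k, ∑ j ∈ range (J + 1),
        (qPochNat q q (k + 1) / (qPochNat q q j * qPochNat q q (k + 1 - j))
          * (qPochNat A q j * qPochNat B q j * D ^ j)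
          * (qPochNat (A * B * D * q ^ j) q (k + 1 - j) * qPochNat D q (k + 1 - j))
        - (1 - A * D * q ^ k) * (1 - B * D * q ^ k) *
          (qPochNat q q k / (qPochNat q q j * qPochNat q q (k - j))
          * (qPochNat A q j * qPochNat B q j * D ^ j)
          * (qPochNat (A * B * D * q ^ j) q (k - j) * qPochNat D q (k - j))))
        = - (qPochNat q q k / (qPochNat q q J * qPochNat q q (k - J))
          * (qPochNat A q (J + 1) * qPochNat B q (J + 1) * D ^ (J + 1))
          * (qPochNat (A * B * D * q ^ J) q (k - J) * qPochNat D q (k - J)) * q ^ (k - J)) := by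
      intro J
      induction J with
      | zero =>
        intro _
        have h := one_sub_pow_ne_zero hq1 k
        have := hne k
        simp only [zero_add, sum_range_one, Nat.sub_zero, qPochNat_succ, qPochNat_zero, pow_zero,
          mul_one, one_mul, pow_one]
        have h' : 1 - q * q ^ k ≠ 0 := by rwa [← pow_succ']
        field_simp
        ring
      | succ J ihJ =>
        intro hJ
        obtain ⟨l, rfl⟩ := Nat.exists_eq_add_of_le hJ
        rw [sum_range_succ, ihJ (by omega)]
        have e1 : J + 1 + l + 1 - (J + 1) = l + 1 := by omega
        have e2 : J + 1 + l - (J + 1) = l := by omega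
        have e3 : J + 1 + l - J = l + 1 := by omega
        have e4 : A * B * D * q ^ J * q = A * B * D * q ^ (J + 1) := by ring
        have h1 := one_sub_pow_ne_zero hq1 l
        have h2 := one_sub_pow_ne_zero hq1 J
        rw [pow_succ'] at h1 h2
        rw [e1, e2, e3, qPochNat_succ' (A * B * D * q ^ J), e4,
          qPochNat_succ (A * B * D * q ^ (J + 1))]
        simp only [qPochNat_succ A q (J + 1), qPochNat_succ B q (J + 1), qPochNat_succ q,
          qPochNat_succ D]
        have := hne J
        have := hne l
        generalize hX : qPochNat (A * B * D * q ^ (J + 1)) q l = X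
        generalize qPochNat A q (J + 1) = PA
        generalize qPochNat B q (J + 1) = PB
        generalize qPochNat D q l = PD
        field_simp
        ring
    have hk := key k le_rfl
    rw [sum_sub_distrib, ← mul_sum, ih] at hk
    rw [sum_range_succ, eq_add_of_sub_eq hk]
    have := hne k
    have := hne (k + 1)
    simp only [Nat.sub_self, qPochNat_zero, pow_zero, mul_one, qPochNat_succ (A * D),
      qPochNat_succ (B * D), div_self (hne k), div_self (hne (k + 1))]
    ring

/-- The `q`-Pfaff--Saalschütz sum `₃φ₂[q^{-k}, A, B; q/b, q/c; q, q]`, balanced by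
`A B b c = q^{k+1}`. Since `q/(bAB) = c q^{-k}`, the usual right-hand side
`(q/(bA), q/(bB); q)_k / (q/b, q/(bAB); q)_k` takes the form below. -/
theorem qSaalschutz {q : ℂ} (hq0 : q ≠ 0) (hq1 : ‖q‖ < 1) {A B b c : ℂ} {k : ℕ}
    (hb0 : b ≠ 0) (hc0 : c ≠ 0) (hbal : A * B * b * c = q ^ (k + 1))
    (hb : qPochNat (q / b) q k ≠ 0) (hc : qPochNat (q / c) q k ≠ 0) :
    ∑ j ∈ range (k + 1), qPochNat (1 / q ^ k) q j * qPochNat A q j * qPochNat B q j * q ^ j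
        / (qPochNat q q j * qPochNat (q / b) q j * qPochNat (q / c) q j)
      = qPochNat (q / (b * A)) q k * qPochNat (q / (b * B)) q k
        / (qPochNat (q / b) q k * qPochNat (c / q ^ k) q k) := by
  have hAB : A * B ≠ 0 := by
    rintro h
    rw [h, zero_mul, zero_mul] at hbal
    exact pow_ne_zero _ hq0 hbal.symm
  have hA := left_ne_zero_of_mul hAB
  have hB := right_ne_zero_of_mul hAB
  have hck : qPochNat (c / q ^ k) q k ≠ 0 := by
    rw [qPochNat_reverse_self hq0 hc0]
    have : -c / q ^ k ≠ 0 := div_ne_zero (neg_ne_zero.2 hc0) (pow_ne_zero _ hq0)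
    exact mul_ne_zero hc (mul_ne_zero (pow_ne_zero _ this) (pow_ne_zero _ hq0))
  have e1 : A * (c / q ^ k) = q / (b * B) := by
    field_simp
    linear_combination hbal
  have e2 : B * (c / q ^ k) = q / (b * A) := by
    field_simp
    linear_combination hbal
  have e3 : A * B * (c / q ^ k) = q / b := by
    rw [mul_assoc, e2]
    field_simp
  have main := qSaalschutz_poly hq1 A B (c / q ^ k) k
  rw [e1, e2, e3] at main
  rw [eq_div_iff (mul_ne_zero hb hck), mul_comm (qPochNat (q / (b * A)) q k), ← main, sum_mul]
  refine sum_congr rfl fun j hj => ?_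
  obtain ⟨l, rfl⟩ := Nat.exists_eq_add_of_le (Nat.lt_succ_iff.1 (mem_range.1 hj))
  have hq := qPochNat_self_ne_zero hq1
  have hbj := qPochNat_ne_zero_of_le (Nat.le_add_right j l) hb
  have hcj := qPochNat_ne_zero_of_le (Nat.le_add_right j l) hc
  have r1 := qPochNat_reverse hq0 (one_ne_zero (α := ℂ)) j l
  rw [div_one] at r1
  have r2 := qPochNat_reverse_self hq0 hc0 j
  have e4 : c / q ^ (j + l) * q ^ l = c / q ^ j := by
    rw [pow_add]
    field_simp
  have s1 : qPochNat (c / q ^ (j + l)) q (j + l)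
      = qPochNat (c / q ^ (j + l)) q l * qPochNat (c / q ^ j) q j := by
    rw [add_comm j l, qPochNat_add, add_comm l j, e4]
  have hx : (-c / q ^ j) ^ j * q ^ (j.choose 2) * ((-1 / q ^ (j + l)) ^ j * q ^ (j.choose 2))
      * q ^ j = (c / q ^ (j + l)) ^ j := by
    have h := pow_choose_two_sq q j
    have hjj : (q ^ j) ^ j ≠ 0 := pow_ne_zero _ (pow_ne_zero _ hq0)
    calc _ = (-c / q ^ j * (-1 / q ^ (j + l))) ^ j
          * (q ^ (j.choose 2) * q ^ (j.choose 2) * q ^ j) := by rw [mul_pow]; ring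
      _ = _ := by
        rw [h, ← mul_pow]
        congr 1
        field_simp
  rw [qPochNat_add (q / b), s1, r2, Nat.add_sub_cancel_left, ← hx]
  have hql := hq l
  have hqj := hq j
  rw [← eq_div_iff hql] at r1
  rw [r1]
  field_simp

/-! ### Expansion in `(q^{-k}, q^k; q)_j` -/

/-- The function `(q^{-k}, q^k; q)_j` of `k`, a polynomial of degree `j` in `q^k + q^{-k}`. -/
noncomputable def symPoch (q : ℂ) (j k : ℕ) : ℂ := qPochNat (1 / q ^ k) q j * qPochNat (q ^ k) q j

/-- Expansion of the part of the summand that depends on `b` and `c` in the functions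
`(q^{-k}, q^k; q)_j` of `k`, an instance of the `q`-Pfaff--Saalschütz sum. -/
theorem expansion_symPoch {q : ℂ} (hq0 : q ≠ 0) (hq1 : ‖q‖ < 1) {b c : ℂ} {k n : ℕ} (hkn : k ≤ n)
    (hb0 : b ≠ 0) (hc0 : c ≠ 0)
    (hb : qPochNat (q / b) q k ≠ 0) (hc : qPochNat (q / c) q k ≠ 0) :
    qPochNat b q k * qPochNat c q k / (qPochNat (q / b) q k * qPochNat (q / c) q k)
        * (q / (b * c)) ^ k
      = ∑ j ∈ range (n + 1), qPochNat (q / (b * c)) q j * q ^ j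
          / (qPochNat q q j * qPochNat (q / b) q j * qPochNat (q / c) q j) * symPoch q j k := by
  have hbal : q ^ k * (q / (b * c)) * b * c = q ^ (k + 1) := by
    field_simp
    ring
  have h := qSaalschutz hq0 hq1 hb0 hc0 hbal hb hc
  have e1 : q / (b * (q / (b * c))) = c := by field_simp
  have e2 : q / (b * q ^ k) = q / b / q ^ k := by field_simp
  have e3 : q / (q / b) = b := by field_simp
  have hqb : q / b ≠ 0 := div_ne_zero hq0 hb0
  rw [e1, e2, qPochNat_reverse_self hq0 hqb, qPochNat_reverse_self hq0 hc0, e3] at h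
  have hsub : range (k + 1) ⊆ range (n + 1) := range_subset_range.2 (by omega)
  rw [← sum_subset hsub]
  · have : ∀ j, qPochNat (q / (b * c)) q j * q ^ j
          / (qPochNat q q j * qPochNat (q / b) q j * qPochNat (q / c) q j) * symPoch q j k
        = qPochNat (1 / q ^ k) q j * qPochNat (q ^ k) q j * qPochNat (q / (b * c)) q j * q ^ j
        / (qPochNat q q j * qPochNat (q / b) q j * qPochNat (q / c) q j) := by
      intro j
      rw [symPoch]
      ring
    simp only [this]
    rw [h]
    have hd : (-(q / b) / q ^ k) = (-c / q ^ k) * (q / (b * c)) := by field_simp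
    have hne : (-c / q ^ k) ^ k ≠ 0 :=
      pow_ne_zero _ (div_ne_zero (neg_ne_zero.2 hc0) (pow_ne_zero _ hq0))
    rw [hd, mul_pow]
    generalize (-c / q ^ k) ^ k = Z at *
    generalize (q / (b * c)) ^ k = W at *
    field_simp
  · intro j _ hj
    rw [symPoch, qPochNat_inv_pow_eq_zero hq0 (by simpa [Nat.lt_succ_iff] using hj)]
    ring

/-! ### The well-poised sum over `d`, `e`, `q^{-n}` -/

/-- The weight `1 + q^k`, halved at `k = 0`: it counts the terms of index `k` and `-k` of a
bilateral sum whose term of index `-k` is `q^k` times that of index `k`. -/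
noncomputable def foldWeight (q : ℂ) (k : ℕ) : ℂ := if k = 0 then 1 else 1 + q ^ k

/-- The term of index `k` of
`₃ψ₃[d, e, q^{-n}; q/d, q/e, q^{n+1}; q, q^{n+1}/(de)]`. -/
noncomputable def psiThreeTerm (q d e : ℂ) (n k : ℕ) : ℂ :=
  qPochNat d q k * qPochNat e q k * qPochNat (1 / q ^ n) q k
    / (qPochNat (q / d) q k * qPochNat (q / e) q k * qPochNat (q ^ (n + 1)) q k)
    * (q ^ (n + 1) / (d * e)) ^ k

theorem psiThreeTerm_succ {q d e : ℂ} (hq0 : q ≠ 0) (hd0 : d ≠ 0) (he0 : e ≠ 0) (n k : ℕ) :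
    psiThreeTerm q d e n (k + 1)
      = psiThreeTerm q d e n k * (-(q * q ^ k) / (d * e) * (1 - d * q ^ k) * (1 - e * q ^ k)
        * (1 - q ^ n / q ^ k)
        / ((1 - q / d * q ^ k) * (1 - q / e * q ^ k) * (1 - q ^ n * q * q ^ k))) := by
  have e1 : (1 - 1 / q ^ n * q ^ k) * (q ^ n * q / (d * e))
      = -(q * q ^ k) / (d * e) * (1 - q ^ n / q ^ k) := by
    field_simp
    ring
  simp only [psiThreeTerm, qPochNat_succ, pow_succ (q ^ (n + 1) / (d * e))]
  rw [pow_succ q n]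
  calc _ = qPochNat d q k * qPochNat e q k * qPochNat (1 / q ^ n) q k
    / (qPochNat (q / d) q k * qPochNat (q / e) q k * qPochNat (q ^ n * q) q k)
    * (q ^ n * q / (d * e)) ^ k * ((1 - d * q ^ k) * (1 - e * q ^ k)
        * ((1 - 1 / q ^ n * q ^ k) * (q ^ n * q / (d * e)))
        / ((1 - q / d * q ^ k) * (1 - q / e * q ^ k) * (1 - q ^ n * q * q ^ k))) := by
        simp only [div_eq_mul_inv, mul_inv]
        ring
    _ = _ := by
        rw [e1]
        ring

/-- Lowering `n`: multiplication by `(1 - q^{n+1+k})(1 - q^{n+1-k})`. -/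
theorem psiThreeTerm_lower {q : ℂ} (hq0 : q ≠ 0) (hq1 : ‖q‖ < 1) (d e : ℂ) (n k : ℕ) :
    psiThreeTerm q d e (n + 1) k * ((1 - q ^ (n + 1) / q ^ k) * (1 - q ^ (n + 1) * q ^ k))
      = (1 - q ^ (n + 1)) ^ 2 * psiThreeTerm q d e n k := by
  have a1 : qPochNat (1 / q ^ (n + 1)) q k * (1 - q ^ (n + 1) / q ^ k)
      = (1 - q ^ (n + 1)) * qPochNat (1 / q ^ n) q k / q ^ k := by
    have h := qPochNat_succ (1 / q ^ (n + 1)) q k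
    have e : 1 / q ^ (n + 1) * q = 1 / q ^ n := by
      field_simp
      ring
    rw [qPochNat_succ', e] at h
    have e2 : 1 - q ^ (n + 1) / q ^ k
        = -(q ^ (n + 1) / q ^ k) * (1 - 1 / q ^ (n + 1) * q ^ k) := by
      field_simp
      ring
    rw [e2, mul_left_comm, ← h]
    field_simp
    ring
  have a2 : (1 - q ^ (n + 1) * q ^ k) / qPochNat (q ^ (n + 1 + 1)) q k
      = (1 - q ^ (n + 1)) / qPochNat (q ^ (n + 1)) q k := by
    have h := qPochNat_succ (q ^ (n + 1)) q k
    rw [qPochNat_succ', ← pow_succ] at h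
    rw [div_eq_div_iff (qPochNat_pow_ne_zero hq1 _ _) (qPochNat_pow_ne_zero hq1 _ _), h]
    ring
  have a3 : (q ^ (n + 1 + 1) / (d * e)) ^ k = (q ^ (n + 1) / (d * e)) ^ k * q ^ k := by
    rw [← mul_pow]
    ring
  unfold psiThreeTerm
  rw [a3]
  calc _ = qPochNat d q k * qPochNat e q k / (qPochNat (q / d) q k * qPochNat (q / e) q k)
        * (q ^ (n + 1) / (d * e)) ^ k * q ^ k
        * (qPochNat (1 / q ^ (n + 1)) q k * (1 - q ^ (n + 1) / q ^ k))
        * ((1 - q ^ (n + 1) * q ^ k) / qPochNat (q ^ (n + 1 + 1)) q k) := by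
        simp only [div_eq_mul_inv, mul_inv]
        ring
    _ = _ := by
        rw [a1, a2]
        field_simp

/-- The sum of the bilateral series `₃ψ₃[d, e, q^{-n}; q/d, q/e, q^{n+1}; q, q^{n+1}/(de)]`,
folded to `k ≥ 0`; it is the limiting case `a = 1` of the terminating very-well-poised `₆φ₅` sum.
The induction on `n` rests on a telescoping (WZ) pair. -/
theorem sum_psiThreeTerm {q d e : ℂ} (hq0 : q ≠ 0) (hq1 : ‖q‖ < 1) (hd0 : d ≠ 0) (he0 : e ≠ 0)
    (n : ℕ) (hd : qPochNat (q / d) q n ≠ 0) (he : qPochNat (q / e) q n ≠ 0) :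
    ∑ k ∈ range (n + 1), foldWeight q k * psiThreeTerm q d e n k
      = qPochNat q q n * qPochNat (q / (d * e)) q n
        / (qPochNat (q / d) q n * qPochNat (q / e) q n) := by
  induction n with
  | zero => simp [foldWeight, psiThreeTerm]
  | succ n ih =>
    have hdn := hd
    have hen := he
    rw [qPochNat_succ] at hdn hen
    have ih := ih (left_ne_zero_of_mul hdn) (left_ne_zero_of_mul hen)
    have hM := one_sub_pow_ne_zero hq1 n
    -- The partial sums of the telescoping difference in closed form; the last factor vanishes at
    -- `K = n + 1`.
    have key : ∀ K ≤ n + 1, ∑ k ∈ range (K + 1),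
        ((1 - q ^ (n + 1)) * (1 - q ^ (n + 1) / d) * (1 - q ^ (n + 1) / e)
            * (foldWeight q k * psiThreeTerm q d e (n + 1) k)
          - (1 - q ^ (n + 1)) ^ 2 * (1 - q ^ (n + 1) / (d * e))
            * (foldWeight q k * psiThreeTerm q d e n k))
        = psiThreeTerm q d e (n + 1) K * (q ^ (n + 1) / (d * e)
          * (1 - d * q ^ K) * (1 - e * q ^ K) * (1 - q ^ (n + 1) / q ^ K)) := by
      intro K
      induction K with
      | zero =>
        intro _
        simp only [zero_add, sum_range_one, foldWeight, psiThreeTerm, qPochNat_zero, if_true,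
          pow_zero]
        field_simp
        ring
      | succ K ihK =>
        intro hK
        have hdK := qPochNat_ne_zero_of_le hK hd
        have heK := qPochNat_ne_zero_of_le hK he
        rw [qPochNat_succ] at hdK heK
        have hdK := right_ne_zero_of_mul hdK
        have heK := right_ne_zero_of_mul heK
        have h3 : 1 - q ^ (n + 1) * q * q ^ K ≠ 0 := by
          convert one_sub_pow_ne_zero hq1 (n + 1 + K) using 2
          ring
        have hl := psiThreeTerm_lower hq0 hq1 d e n (K + 1)
        rw [sum_range_succ, ihK (by omega), foldWeight, if_neg K.succ_ne_zero]
        have hs := psiThreeTerm_succ hq0 hd0 he0 (n + 1) K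
        have hl' : (1 - q ^ (n + 1)) ^ 2 * (1 - q ^ (n + 1) / (d * e))
            * ((1 + q ^ (K + 1)) * psiThreeTerm q d e n (K + 1))
            = (1 - q ^ (n + 1) / (d * e)) * (1 + q ^ (K + 1))
              * (psiThreeTerm q d e (n + 1) (K + 1)
                * ((1 - q ^ (n + 1) / q ^ (K + 1)) * (1 - q ^ (n + 1) * q ^ (K + 1)))) := by
          rw [hl]
          ring
        rw [hl']
        have hX : psiThreeTerm q d e (n + 1) K * (q ^ (n + 1) / (d * e) * (1 - d * q ^ K)
            * (1 - e * q ^ K) * (1 - q ^ (n + 1) / q ^ K))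
            = - (q ^ (n + 1) / q ^ (K + 1)) * psiThreeTerm q d e (n + 1) (K + 1)
            * ((1 - q / d * q ^ K) * (1 - q / e * q ^ K) * (1 - q ^ (n + 1) * q * q ^ K)) := by
          rw [hs]
          generalize psiThreeTerm q d e (n + 1) K = X
          generalize hu : 1 - q / d * q ^ K = u at *
          generalize hv : 1 - q / e * q ^ K = v at *
          generalize hw : 1 - q ^ (n + 1) * q * q ^ K = w at *
          rw [pow_succ q K]
          field_simp
        rw [hX]
        generalize psiThreeTerm q d e (n + 1) (K + 1) = X
        rw [pow_succ q K]
        generalize q ^ (n + 1) = M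
        have hx := pow_ne_zero K hq0
        generalize q ^ K = x at *
        field_simp
        ring
    have hk := key (n + 1) le_rfl
    have hz : psiThreeTerm q d e n (n + 1) = 0 := by
      rw [psiThreeTerm, qPochNat_inv_pow_eq_zero hq0 n.lt_succ_self]
      ring
    rw [div_self (pow_ne_zero _ hq0), sub_self, mul_zero, mul_zero, sum_sub_distrib, ← mul_sum,
      ← mul_sum, sub_eq_zero, sum_range_succ (fun k => foldWeight q k * psiThreeTerm q d e n k),
      hz, mul_zero, add_zero, ih] at hk
    have f : ∀ x : ℂ, q / x * q ^ n = q ^ (n + 1) / x := fun x => by ring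
    rw [f] at hdn hen
    have hdn' := right_ne_zero_of_mul hdn
    have hen' := right_ne_zero_of_mul hen
    have hdn := left_ne_zero_of_mul hdn
    have hen := left_ne_zero_of_mul hen
    refine mul_left_cancel₀ (mul_ne_zero (mul_ne_zero hM hdn') hen') (hk.trans ?_)
    simp only [qPochNat_succ, f, ← pow_succ']
    generalize 1 - q ^ (n + 1) / d = u at *
    generalize 1 - q ^ (n + 1) / e = v at *
    generalize 1 - q ^ (n + 1) / (d * e) = w at *
    field_simp

/-- The moments of `psiThreeTerm` against `(q^{-k}, q^k; q)_j`. The induction on `j` uses that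
`q^{n-j}(1 - q^{j+k})(1 - q^{j-k}) = (1 - q^{n+k})(1 - q^{n-k}) - (1 - q^{n-j})(1 - q^{n+j})`,
where the first factor on the right lowers `n` in `psiThreeTerm` and the second is free of `k`. -/
theorem sum_psiThreeTerm_mul_symPoch {q d e : ℂ} (hq0 : q ≠ 0) (hq1 : ‖q‖ < 1)
    (hd0 : d ≠ 0) (he0 : e ≠ 0) (j l : ℕ)
    (hd : qPochNat (q / d) q (j + l) ≠ 0) (he : qPochNat (q / e) q (j + l) ≠ 0) :
    ∑ k ∈ range (j + l + 1), foldWeight q k * psiThreeTerm q d e (j + l) k * symPoch q j k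
      = qPochNat q q (j + l) / (qPochNat (q / d) q (j + l) * qPochNat (q / e) q (j + l))
        * (qPochNat (1 / q ^ (j + l)) q j * qPochNat d q j * qPochNat e q j)
        * (qPochNat (q / (d * e)) q l / ((-(d * e) / q ^ (j + l)) ^ j * q ^ (j.choose 2))) := by
  induction j generalizing l with
  | zero =>
    have h := sum_psiThreeTerm hq0 hq1 hd0 he0 (0 + l) hd he
    simp only [symPoch, qPochNat_zero, mul_one, h]
    simp only [zero_add, pow_zero, Nat.choose_zero_succ, mul_one, div_one]
    ring
  | succ j ih =>
    have e0 : j + 1 + l = j + l + 1 := by ring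
    rw [e0] at hd he ⊢
    have ih1 := ih (l + 1) hd he
    have hd' := hd
    have he' := he
    rw [qPochNat_succ] at hd' he'
    have ih2 := ih l (left_ne_zero_of_mul hd') (left_ne_zero_of_mul he')
    have pt : ∀ k, q ^ (l + 1)
          * (foldWeight q k * psiThreeTerm q d e (j + l + 1) k * symPoch q (j + 1) k)
        = (1 - q ^ (j + l + 1)) ^ 2 * (foldWeight q k * psiThreeTerm q d e (j + l) k * symPoch q j k)
          - (1 - q ^ (l + 1)) * (1 - q ^ (j + l + 1 + j))
            * (foldWeight q k * psiThreeTerm q d e (j + l + 1) k * symPoch q j k) := by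
      intro k
      have h := psiThreeTerm_lower hq0 hq1 d e (j + l) k
      have hx := pow_ne_zero k hq0
      have alg : q ^ (l + 1) * ((1 - 1 / q ^ k * q ^ j) * (1 - q ^ k * q ^ j))
          = (1 - q ^ (j + l + 1) / q ^ k) * (1 - q ^ (j + l + 1) * q ^ k)
            - (1 - q ^ (l + 1)) * (1 - q ^ (j + l + 1 + j)) := by
        field_simp
        ring
      have hsym : symPoch q (j + 1) k
          = symPoch q j k * ((1 - 1 / q ^ k * q ^ j) * (1 - q ^ k * q ^ j)) := by
        rw [symPoch, symPoch, qPochNat_succ, qPochNat_succ]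
        ring
      rw [hsym]
      linear_combination foldWeight q k * symPoch q j k * h
        + foldWeight q k * psiThreeTerm q d e (j + l + 1) k * symPoch q j k * alg
    have hz : psiThreeTerm q d e (j + l) (j + l + 1) = 0 := by
      rw [psiThreeTerm, qPochNat_inv_pow_eq_zero hq0 (j + l).lt_succ_self]
      ring
    refine mul_left_cancel₀ (pow_ne_zero (l + 1) hq0) ?_
    rw [mul_sum, sum_congr rfl fun k _ => pt k, sum_sub_distrib, ← mul_sum, ← mul_sum]
    rw [← add_assoc] at ih1
    rw [ih1, sum_range_succ, hz, ih2]
    have a1 : qPochNat (1 / q ^ (j + l + 1)) q (j + 1)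
        = (1 - 1 / q ^ (j + l + 1)) * qPochNat (1 / q ^ (j + l)) q j := by
      rw [qPochNat_succ']
      congr 2
      field_simp
      ring
    have a2 : qPochNat (1 / q ^ (j + l + 1)) q j * (1 - 1 / q ^ (l + 1))
        = (1 - 1 / q ^ (j + l + 1)) * qPochNat (1 / q ^ (j + l)) q j := by
      rw [← a1, qPochNat_succ]
      congr 2
      field_simp
      ring
    have hl := one_sub_pow_ne_zero hq1 l
    have hl' : 1 - 1 / q ^ (l + 1) ≠ 0 := by
      rw [one_sub_div (pow_ne_zero _ hq0)]
      exact div_ne_zero (by rw [← neg_sub]; exact neg_ne_zero.2 hl) (pow_ne_zero _ hq0)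
    rw [← eq_div_iff hl'] at a2
    have a3 : (-(d * e) / q ^ (j + l)) ^ j = (-(d * e) / q ^ (j + l + 1)) ^ j * q ^ j := by
      rw [← mul_pow]
      congr 1
      field_simp
      ring
    have hu := left_ne_zero_of_mul hd'
    have hv := left_ne_zero_of_mul he'
    have hu' := right_ne_zero_of_mul hd'
    have hv' := right_ne_zero_of_mul he'
    have hY : (-(d * e) / q ^ (j + l + 1)) ^ j ≠ 0 := pow_ne_zero _
      (div_ne_zero (neg_ne_zero.2 (mul_ne_zero hd0 he0)) (pow_ne_zero _ hq0))
    rw [a1, a2, a3, pow_choose_two_succ, pow_succ (-(d * e) / q ^ (j + l + 1))]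
    simp only [qPochNat_succ]
    generalize (-(d * e) / q ^ (j + l + 1)) ^ j = Y at *
    have hqj := pow_ne_zero j hq0
    have hql := pow_ne_zero l hq0
    have hC := pow_ne_zero (j.choose 2) hq0
    generalize q ^ (j.choose 2) = C at *
    have f : ∀ x : ℂ, q / x * q ^ (j + l) = q * q ^ j * q ^ l / x := fun x => by ring
    have g : q ^ (j + l + 1) = q * q ^ j * q ^ l := by ring
    have g' : q ^ (l + 1) = q * q ^ l := by ring
    have g2 : q ^ (j + l + 1 + j) = q * q ^ j * q ^ l * q ^ j := by ring
    have g3 : q * q ^ (j + l) = q * q ^ j * q ^ l := by ring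
    rw [f] at hu' hv'
    simp only [f, g, g', g2, g3] at *
    generalize q ^ j = x at *
    generalize q ^ l = y at *
    have hu'' : d - q * x * y ≠ 0 := by
      intro h
      exact hu' (by rw [← sub_eq_zero.1 h, div_self hd0, sub_self])
    have hv'' : e - q * x * y ≠ 0 := by
      intro h
      exact hv' (by rw [← sub_eq_zero.1 h, div_self he0, sub_self])
    have hl2 : q * y - 1 ≠ 0 := by
      rw [← neg_sub]
      exact neg_ne_zero.2 hl
    field_simp
    ring

/-! ### Watson's transformation at `a = 1` -/

/-- The limiting case `a = 1` of Watson's transformation, folded to `k ≥ 0`, in a form without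
division by `(de q^{-n}; q)_j`, hence valid without a condition on `de`. -/
theorem sum_psiFive_eq {q b c d e : ℂ} (hq0 : q ≠ 0) (hq1 : ‖q‖ < 1) (n : ℕ)
    (hb0 : b ≠ 0) (hc0 : c ≠ 0) (hd0 : d ≠ 0) (he0 : e ≠ 0)
    (hb : qPochNat (q / b) q n ≠ 0) (hc : qPochNat (q / c) q n ≠ 0)
    (hd : qPochNat (q / d) q n ≠ 0) (he : qPochNat (q / e) q n ≠ 0) :
    ∑ k ∈ range (n + 1), foldWeight q k * (psiThreeTerm q d e n k
        * (qPochNat b q k * qPochNat c q k / (qPochNat (q / b) q k * qPochNat (q / c) q k)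
          * (q / (b * c)) ^ k))
      = ∑ j ∈ range (n + 1), qPochNat (q / (b * c)) q j * q ^ j
          / (qPochNat q q j * qPochNat (q / b) q j * qPochNat (q / c) q j)
        * (qPochNat q q n / (qPochNat (q / d) q n * qPochNat (q / e) q n)
        * (qPochNat (1 / q ^ n) q j * qPochNat d q j * qPochNat e q j)
        * (qPochNat (q / (d * e)) q (n - j)
          / ((-(d * e) / q ^ n) ^ j * q ^ (j.choose 2)))) := by
  have h1 : ∀ k ∈ range (n + 1), foldWeight q k * (psiThreeTerm q d e n k
        * (qPochNat b q k * qPochNat c q k / (qPochNat (q / b) q k * qPochNat (q / c) q k)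
          * (q / (b * c)) ^ k))
      = ∑ j ∈ range (n + 1), qPochNat (q / (b * c)) q j * q ^ j
          / (qPochNat q q j * qPochNat (q / b) q j * qPochNat (q / c) q j)
          * (foldWeight q k * psiThreeTerm q d e n k * symPoch q j k) := by
    intro k hk
    have hkn := Nat.lt_succ_iff.1 (mem_range.1 hk)
    rw [expansion_symPoch hq0 hq1 hkn hb0 hc0 (qPochNat_ne_zero_of_le hkn hb)
      (qPochNat_ne_zero_of_le hkn hc), mul_sum, mul_sum]
    exact sum_congr rfl fun j _ => by ring
  rw [sum_congr rfl h1, sum_comm]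
  refine sum_congr rfl fun j hj => ?_
  obtain ⟨l, rfl⟩ := Nat.exists_eq_add_of_le (Nat.lt_succ_iff.1 (mem_range.1 hj))
  rw [← mul_sum, sum_psiThreeTerm_mul_symPoch hq0 hq1 hd0 he0 j l hd he, Nat.add_sub_cancel_left]

/-! ### The series as finite sums -/

/-- The effect of `k ↦ -k` on the factors `(b; q)_k / (q/b; q)_k`. No denominator has to be
nonzero: both sides vanish if one does. -/
theorem qPoch_neg_div {q b : ℂ} (hq0 : q ≠ 0) (hb0 : b ≠ 0) (m : ℕ) :
    qPoch b q (-(m : ℤ)) / qPoch (q / b) q (-(m : ℤ))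
      = (q / b ^ 2) ^ m * (qPochNat b q m / qPochNat (q / b) q m) := by
  have hneg : ∀ a : ℂ, qPoch a q (-(m : ℤ))
      = (∏ i ∈ range m, (1 - a * q ^ (-((i : ℤ) + 1))))⁻¹ := by
    intro a
    cases m with
    | zero => simp [show qPoch a q 0 = 1 from qPochNat_zero a q]
    | succ m => rfl
  rw [hneg, hneg, inv_div_inv, qPochNat, qPochNat, ← prod_div_distrib, ← prod_div_distrib,
    ← card_range m, ← prod_const, card_range, ← prod_mul_distrib]
  refine prod_congr rfl fun i _ => ?_
  have hz : q ^ (-((i : ℤ) + 1)) = 1 / (q * q ^ i) := by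
    rw [zpow_neg, ← Nat.cast_succ, zpow_natCast, pow_succ', one_div]
  rw [hz]
  have hx := pow_ne_zero i hq0
  generalize q ^ i = x at *
  have e1 : 1 - q / b * (1 / (q * x)) = -(1 / (b * x)) * (1 - b * x) := by
    field_simp
    ring
  have e2 : 1 - b * (1 / (q * x)) = -(b / (q * x)) * (1 - q / b * x) := by
    field_simp
    ring
  rw [e1, e2, mul_div_mul_comm]
  congr 1
  field_simp

theorem psiTerm_natCast_eq {q b c d e x : ℂ} (n k : ℕ) :
    psiTerm [b, c, d, e, q ^ (-(n : ℤ))] [q / b, q / c, q / d, q / e, q ^ (n + 1)] q x k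
      = qPochNat b q k / qPochNat (q / b) q k * (qPochNat c q k / qPochNat (q / c) q k)
        * (qPochNat d q k / qPochNat (q / d) q k) * (qPochNat e q k / qPochNat (q / e) q k)
        * (qPochNat (1 / q ^ n) q k / qPochNat (q ^ (n + 1)) q k) * x ^ k := by
  have e1 : q ^ (-(n : ℤ)) = 1 / q ^ n := by rw [zpow_neg, zpow_natCast, one_div]
  simp only [psiTerm, qPochMulti, List.map_cons, List.map_nil, List.prod_cons, List.prod_nil,
    mul_one, qPoch_natCast, e1, zpow_natCast]
  simp only [div_eq_mul_inv, mul_inv]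
  ring

theorem psiTerm_neg {q b c d e : ℂ} (hq0 : q ≠ 0) (hb0 : b ≠ 0) (hc0 : c ≠ 0)
    (hd0 : d ≠ 0) (he0 : e ≠ 0) (n m : ℕ) :
    psiTerm [b, c, d, e, q ^ (-(n : ℤ))] [q / b, q / c, q / d, q / e, q ^ (n + 1)] q
        (q ^ (2 + n) / (b * c * d * e)) (-(m : ℤ))
      = q ^ m * psiTerm [b, c, d, e, q ^ (-(n : ℤ))] [q / b, q / c, q / d, q / e, q ^ (n + 1)] q
        (q ^ (2 + n) / (b * c * d * e)) m := by
  have e1 : q ^ (-(n : ℤ)) = 1 / q ^ n := by rw [zpow_neg, zpow_natCast, one_div]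
  have e2 : q ^ (n + 1) = q / (1 / q ^ n) := by
    field_simp
    ring
  have hn : 1 / q ^ n ≠ 0 := one_div_ne_zero (pow_ne_zero _ hq0)
  rw [psiTerm_natCast_eq, e1]
  simp only [psiTerm, qPochMulti, List.map_cons, List.map_nil, List.prod_cons, List.prod_nil,
    mul_one, zpow_neg (q ^ (2 + n) / (b * c * d * e)), zpow_natCast]
  have hx : q ^ m * (q ^ (2 + n) / (b * c * d * e)) ^ m
      = (q / b ^ 2) ^ m * (q / c ^ 2) ^ m * (q / d ^ 2) ^ m * (q / e ^ 2) ^ m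
        * (q / (1 / q ^ n) ^ 2) ^ m * ((q ^ (2 + n) / (b * c * d * e)) ^ m)⁻¹ := by
    simp only [← mul_pow, ← inv_pow]
    congr 1
    field_simp
    ring
  have r : ∀ a : ℂ, a ≠ 0 → qPoch a q (-(m : ℤ)) * (qPoch (q / a) q (-(m : ℤ)))⁻¹
      = (q / a ^ 2) ^ m * (qPochNat a q m / qPochNat (q / a) q m) :=
    fun a ha => by rw [← div_eq_mul_inv, qPoch_neg_div hq0 ha]
  rw [e2]
  calc _ = (qPoch b q (-(m : ℤ)) * (qPoch (q / b) q (-(m : ℤ)))⁻¹)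
      * (qPoch c q (-(m : ℤ)) * (qPoch (q / c) q (-(m : ℤ)))⁻¹)
      * (qPoch d q (-(m : ℤ)) * (qPoch (q / d) q (-(m : ℤ)))⁻¹)
      * (qPoch e q (-(m : ℤ)) * (qPoch (q / e) q (-(m : ℤ)))⁻¹)
      * (qPoch (1 / q ^ n) q (-(m : ℤ)) * (qPoch (q / (1 / q ^ n)) q (-(m : ℤ)))⁻¹)
      * ((q ^ (2 + n) / (b * c * d * e)) ^ m)⁻¹ := by
        simp only [div_eq_mul_inv, mul_inv]
        ring
    _ = _ := by
        rw [r b hb0, r c hc0, r d hd0, r e he0, r _ hn]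
        linear_combination -(qPochNat b q m / qPochNat (q / b) q m
          * (qPochNat c q m / qPochNat (q / c) q m) * (qPochNat d q m / qPochNat (q / d) q m)
          * (qPochNat e q m / qPochNat (q / e) q m)
          * (qPochNat (1 / q ^ n) q m / qPochNat (q / (1 / q ^ n)) q m)) * hx

/-- The bilateral series is a finite sum, which folds to indices `k ≥ 0`. -/
theorem hasSum_psiTerm {q b c d e : ℂ} (hq0 : q ≠ 0) (hb0 : b ≠ 0) (hc0 : c ≠ 0)
    (hd0 : d ≠ 0) (he0 : e ≠ 0) (n : ℕ) :
    HasSum (psiTerm [b, c, d, e, q ^ (-(n : ℤ))] [q / b, q / c, q / d, q / e, q ^ (n + 1)] q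
        (q ^ (2 + n) / (b * c * d * e)))
      (∑ k ∈ range (n + 1), foldWeight q k * (psiThreeTerm q d e n k
        * (qPochNat b q k * qPochNat c q k / (qPochNat (q / b) q k * qPochNat (q / c) q k)
          * (q / (b * c)) ^ k))) := by
  set t := psiTerm [b, c, d, e, q ^ (-(n : ℤ))] [q / b, q / c, q / d, q / e, q ^ (n + 1)] q
        (q ^ (2 + n) / (b * c * d * e)) with ht
  have hz : ∀ k : ℕ, n < k → t k = 0 := by
    intro k hk
    rw [ht, psiTerm_natCast_eq, qPochNat_inv_pow_eq_zero hq0 hk]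
    ring
  have hneg : ∀ m : ℕ, t (-(m : ℤ)) = q ^ m * t m := psiTerm_neg hq0 hb0 hc0 hd0 he0 n
  have h1 : HasSum (fun k : ℕ => t k) (∑ k ∈ range (n + 1), t k) :=
    hasSum_sum_of_ne_finset_zero fun k hk => hz k (by simpa using hk)
  have h2 : HasSum (fun m : ℕ => t (-((m : ℤ) + 1)))
      (∑ m ∈ range n, t (-((m : ℤ) + 1))) :=
    hasSum_sum_of_ne_finset_zero fun m hm => by
      have := hneg (m + 1)
      rw [hz _ (by simpa [Nat.lt_succ_iff] using hm), mul_zero] at this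
      exact_mod_cast this
  have h := HasSum.of_nat_of_neg_add_one h1 h2
  convert h using 1
  have hterm : ∀ k : ℕ, psiThreeTerm q d e n k
        * (qPochNat b q k * qPochNat c q k / (qPochNat (q / b) q k * qPochNat (q / c) q k)
          * (q / (b * c)) ^ k) = t k := by
    intro k
    have hx : (q ^ (2 + n) / (b * c * d * e)) ^ k
        = (q ^ (n + 1) / (d * e)) ^ k * (q / (b * c)) ^ k := by
      rw [← mul_pow]
      congr 1
      field_simp
      ring
    rw [ht, psiTerm_natCast_eq, hx, psiThreeTerm]
    simp only [div_eq_mul_inv, mul_inv]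
    ring
  simp only [hterm]
  rw [sum_range_succ', sum_range_succ' (fun k : ℕ => t k)]
  have hneg' : ∀ m : ℕ, t (-((m : ℤ) + 1)) = q ^ (m + 1) * t ((m + 1 : ℕ) : ℤ) := fun m => by
    rw [← hneg (m + 1)]
    push_cast
    rfl
  simp only [hneg', foldWeight, Nat.succ_ne_zero, if_false, if_true, add_mul, one_mul,
    sum_add_distrib]
  ring

theorem phiTerm_eq {q b c d e : ℂ} (n k : ℕ) :
    phiTerm [q ^ (-(n : ℤ)), d, e, q / (b * c)] [q / b, q / c, d * e * q ^ (-(n : ℤ))] q q k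
      = qPochNat (1 / q ^ n) q k * qPochNat d q k * qPochNat e q k * qPochNat (q / (b * c)) q k
        / (qPochNat (q / b) q k * qPochNat (q / c) q k * qPochNat (d * e / q ^ n) q k)
        * (q ^ k / qPochNat q q k) := by
  have e1 : q ^ (-(n : ℤ)) = 1 / q ^ n := by rw [zpow_neg, zpow_natCast, one_div]
  have e2 : d * e * (1 / q ^ n) = d * e / q ^ n := by ring
  have e3 : (([q / b, q / c, d * e * q ^ (-(n : ℤ))] : List ℂ).length : ℤ) + 1
      - (([q ^ (-(n : ℤ)), d, e, q / (b * c)] : List ℂ).length : ℤ) = 0 := by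
    simp only [List.length_cons, List.length_nil]
    norm_num
  rw [phiTerm, e3, zpow_zero, mul_one]
  simp only [qPochMulti, List.map_cons, List.map_nil, List.prod_cons, List.prod_nil,
    mul_one, qPoch_natCast, e1, e2]
  simp only [div_eq_mul_inv, mul_inv]
  ring

theorem hasSum_phiTerm {q b c d e : ℂ} (hq0 : q ≠ 0) (n : ℕ) :
    HasSum (phiTerm [q ^ (-(n : ℤ)), d, e, q / (b * c)]
        [q / b, q / c, d * e * q ^ (-(n : ℤ))] q q)
      (∑ k ∈ range (n + 1), phiTerm [q ^ (-(n : ℤ)), d, e, q / (b * c)]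
        [q / b, q / c, d * e * q ^ (-(n : ℤ))] q q k) :=
  hasSum_sum_of_ne_finset_zero fun k hk => by
    rw [phiTerm_eq, qPochNat_inv_pow_eq_zero hq0 (by simpa [Nat.lt_succ_iff] using hk)]
    ring

theorem mainTheorem3 (n : ℕ) (q b c d e : ℂ)
    (hq0 : q ≠ 0) (hq1 : ‖q‖ < 1)
    (hb0 : b ≠ 0) (hc0 : c ≠ 0) (hd0 : d ≠ 0) (he0 : e ≠ 0)
    (hb : ∀ j ∈ Finset.Icc 1 n, b ≠ q ^ j) (hc : ∀ j ∈ Finset.Icc 1 n, c ≠ q ^ j)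
    (hd : ∀ j ∈ Finset.Icc 1 n, d ≠ q ^ j) (he : ∀ j ∈ Finset.Icc 1 n, e ≠ q ^ j) :
    ((∀ j ∈ Finset.Icc 1 n, d * e ≠ q ^ j) →
      Summable (psiTerm [b, c, d, e, q ^ (-(n : ℤ))] [q / b, q / c, q / d, q / e, q ^ (n + 1)]
        q (q ^ (2 + n) / (b * c * d * e))) ∧
      Summable (phiTerm [q ^ (-(n : ℤ)), d, e, q / (b * c)]
        [q / b, q / c, d * e * q ^ (-(n : ℤ))] q q) ∧
      psiSeries [b, c, d, e, q ^ (-(n : ℤ))] [q / b, q / c, q / d, q / e, q ^ (n + 1)]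
          q (q ^ (2 + n) / (b * c * d * e))
        = qPochMulti [q, q / (d * e)] q n / qPochMulti [q / d, q / e] q n
          * phiSeries [q ^ (-(n : ℤ)), d, e, q / (b * c)]
              [q / b, q / c, d * e * q ^ (-(n : ℤ))] q q) ∧
    (b * c * d * e * q ^ (-(n : ℤ)) = q →
      Summable (psiTerm [b, c, d, e, q ^ (-(n : ℤ))] [q / b, q / c, q / d, q / e, q ^ (n + 1)]
        q q) ∧
      psiSeries [b, c, d, e, q ^ (-(n : ℤ))] [q / b, q / c, q / d, q / e, q ^ (n + 1)] q q
        = qPochMulti [q, q / (b * d), q / (b * e), q / (d * e)] q n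
          / qPochMulti [q / b, q / d, q / e, q / (b * d * e)] q n) := by
  have hb' := qPochNat_div_ne_zero hb0 hb
  have hc' := qPochNat_div_ne_zero hc0 hc
  have hd' := qPochNat_div_ne_zero hd0 hd
  have he' := qPochNat_div_ne_zero he0 he
  have hpsi := hasSum_psiTerm hq0 hb0 hc0 hd0 he0 n
  rw [sum_psiFive_eq hq0 hq1 n hb0 hc0 hd0 he0 hb' hc' hd' he'] at hpsi
  have hqn := pow_ne_zero n hq0
  have hde0 := mul_ne_zero hd0 he0
  -- The monomial factor by which `(de q^{-n}; q)_j` differs from the last `j` factors of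
  -- `(q/(de); q)_n`.
  have hκ : ∀ j : ℕ, (-(d * e) / q ^ n) ^ j * q ^ (j.choose 2) ≠ 0 := fun j =>
    mul_ne_zero (pow_ne_zero _ (div_ne_zero (neg_ne_zero.2 hde0) hqn)) (pow_ne_zero _ hq0)
  have hrev : ∀ j ∈ range (n + 1), qPochNat (d * e / q ^ n) q j
      * (qPochNat (q / (d * e)) q (n - j) / ((-(d * e) / q ^ n) ^ j * q ^ (j.choose 2)))
        = qPochNat (q / (d * e)) q n := by
    intro j hj
    obtain ⟨l, rfl⟩ := Nat.exists_eq_add_of_le (Nat.lt_succ_iff.1 (mem_range.1 hj))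
    rw [Nat.add_sub_cancel_left, ← mul_div_assoc, div_eq_iff (hκ j)]
    exact qPochNat_reverse hq0 hde0 j l
  constructor
  · intro hde
    have hphi := hasSum_phiTerm (b := b) (c := c) (d := d) (e := e) hq0 n
    refine ⟨hpsi.summable, hphi.summable, ?_⟩
    rw [psiSeries, hpsi.tsum_eq, phiSeries, hphi.tsum_eq, mul_sum]
    refine sum_congr rfl fun j hj => ?_
    have hden : qPochNat (d * e / q ^ n) q j ≠ 0 := by
      have hjn := Nat.lt_succ_iff.1 (mem_range.1 hj)
      refine qPochNat_ne_zero fun i hi h => hde (n - i) (mem_Icc.2 ⟨by omega, by omega⟩) ?_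
      rw [← Nat.sub_add_cancel (show i ≤ n by omega), pow_add] at h
      have := pow_ne_zero i hq0
      have := pow_ne_zero (n - i) hq0
      field_simp at h
      exact h
    have h := hrev j hj
    rw [mul_comm, ← eq_div_iff hden] at h
    rw [h, phiTerm_eq]
    simp only [qPochMulti, List.map_cons, List.map_nil, List.prod_cons, List.prod_nil, mul_one,
      qPoch_natCast, div_eq_mul_inv, mul_inv]
    ring
  · intro hbal
    have hbal' : d * e * b * c = q ^ (n + 1) := by
      rw [zpow_neg, zpow_natCast, ← div_eq_mul_inv, div_eq_iff hqn] at hbal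
      rw [pow_succ', ← hbal]
      ring
    have hx : q ^ (2 + n) / (b * c * d * e) = q := by
      rw [show b * c * d * e = q ^ (n + 1) by rw [← hbal']; ring]
      field_simp
      ring
    have hbc : q / (b * c) = d * e / q ^ n := by
      rw [div_eq_div_iff (mul_ne_zero hb0 hc0) hqn, ← pow_succ', ← hbal']
      ring
    have hbde : q / (b * d * e) = c / q ^ n := by
      rw [div_eq_div_iff (mul_ne_zero (mul_ne_zero hb0 hd0) he0) hqn, ← pow_succ', ← hbal']
      ring
    rw [hx] at hpsi
    refine ⟨hpsi.summable, ?_⟩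
    rw [psiSeries, hpsi.tsum_eq, hbc, hbde]
    -- Now `(q/(bc); q)_j` cancels the denominator factor `(de q^{-n}; q)_j`, and a balanced
    -- `₃φ₂` remains.
    have hterm : ∀ j ∈ range (n + 1), qPochNat (d * e / q ^ n) q j * q ^ j
          / (qPochNat q q j * qPochNat (q / b) q j * qPochNat (q / c) q j)
        * (qPochNat q q n / (qPochNat (q / d) q n * qPochNat (q / e) q n)
        * (qPochNat (1 / q ^ n) q j * qPochNat d q j * qPochNat e q j)
        * (qPochNat (q / (d * e)) q (n - j)
          / ((-(d * e) / q ^ n) ^ j * q ^ (j.choose 2))))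
        = qPochNat q q n * qPochNat (q / (d * e)) q n
            / (qPochNat (q / d) q n * qPochNat (q / e) q n)
          * (qPochNat (1 / q ^ n) q j * qPochNat d q j * qPochNat e q j * q ^ j
        / (qPochNat q q j * qPochNat (q / b) q j * qPochNat (q / c) q j)) := by
      intro j hj
      rw [← hrev j hj]
      ring
    rw [sum_congr rfl hterm, ← mul_sum, qSaalschutz hq0 hq1 hb0 hc0 hbal' hb' hc']
    simp only [qPochMulti, List.map_cons, List.map_nil, List.prod_cons, List.prod_nil, mul_one,
      qPoch_natCast, div_eq_mul_inv, mul_inv]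
    ring
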